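/- Let $N_5$ denote the pentagon, i.e. the five-element lattice $\{0,p,q,r,1\}$ with least element $0$, greatest element $1$, $p<q$, and $r$ incomparable to both $p$ and $q$. Let $\mathcal{N}$ be the variety of lattices generated by $N_5$, i.e. the class of all lattices that satisfy every lattice identity holding in $N_5$. Let $L \in \mathcal{N}$ be a lattice that is isomorphic to a sublattice of a free lattice. Write $x \parallel y$ if neither $x \leq y$ nor $y \leq x$. Then both of the following hold. (1) Let $a, b_1, b_2, b_3, b_4, b_5 \in L$ be such that $a \parallel b_i$ for all $1 \leq i \leq 5$, and $b_i < b_{i+1}$ and $a \vee b_i < a \vee b_{i+1}$ for all $1 \leq i \leq 4$. If $(a \vee b_4) \wedge b_5 \neq b_4$, then $(a \vee b_3) \wedge b_5$ is covered by $a \vee b_3$ in $L$; that is, $(a \vee b_3) \wedge b_5 < a \vee b_3$ and no element of $L$ lies strictly between them. (2) (The dual.) Let $a, b_1, b_2, b_3, b_4, b_5 \in L$ be such that $a \parallel b_i$ for all $1 \leq i \leq 5$, and $b_i > b_{i+1}$ and $a \wedge b_i > a \wedge b_{i+1}$ for all $1 \leq i \leq 4$. If $(a \wedge b_4) \vee b_5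 \neq b_4$, then $(a \wedge b_3) \vee b_5$ covers $a \wedge b_3$ in $L$. -/

import Mathlib

universe u v

/-- Lattice terms in the variables `α`. -/
inductive LatticeTerm (α : Type u) : Type u
  | var : α → LatticeTerm α
  | sup : LatticeTerm α → LatticeTerm α → LatticeTerm α
  | inf : LatticeTerm α → LatticeTerm α → LatticeTerm α

namespace LatticeTerm

/-- The value of a lattice term in a lattice `L` under an assignment of its variables. -/
def eval {α : Type u} {L : Type v} [Lattice L] (f : α → L) : LatticeTerm α → L
  | var x => f x
  | sup s t => eval f s ⊔ eval f t
  | inf s t => eval f s ⊓ eval f t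

/-- The inequalities `s ≤ t` between lattice terms that are derivable from the axioms of
lattices: the least preorder for which `sup` is a join and `inf` is a meet. -/
inductive Le {α : Type u} : LatticeTerm α → LatticeTerm α → Prop
  | refl (s : LatticeTerm α) : Le s s
  | trans {s t w : LatticeTerm α} : Le s t → Le t w → Le s w
  | le_sup_left (s t : LatticeTerm α) : Le s (sup s t)
  | le_sup_right (s t : LatticeTerm α) : Le t (sup s t)
  | sup_le {s t w : LatticeTerm α} : Le s w → Le t w → Le (sup s t) w
  | inf_le_left (s t : LatticeTerm α) : Le (inf s t) s
  | inf_le_right (s t : LatticeTerm α) : Le (inf s t) t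
  | le_inf {s t w : LatticeTerm α} : Le w s → Le w t → Le w (inf s t)

instance {α : Type u} : Preorder (LatticeTerm α) where
  le := Le
  le_refl := Le.refl
  le_trans _ _ _ := Le.trans

theorem eval_mono {α : Type u} {L : Type v} [Lattice L] (f : α → L) {s t : LatticeTerm α}
    (h : s ≤ t) : eval f s ≤ eval f t := by
  induction h with
  | refl s => exact _root_.le_refl _
  | trans _ _ h₁ h₂ => exact _root_.le_trans h₁ h₂
  | le_sup_left s t => exact _root_.le_sup_left
  | le_sup_right s t => exact _root_.le_sup_right
  | sup_le _ _ h₁ h₂ => exact _root_.sup_le h₁ h₂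
  | inf_le_left s t => exact _root_.inf_le_left
  | inf_le_right s t => exact _root_.inf_le_right
  | le_inf _ _ h₁ h₂ => exact _root_.le_inf h₁ h₂

end LatticeTerm

/-- The free lattice on `α`: lattice terms, ordered by derivable inequality, modulo
mutual inequality. -/
def FreeLattice (α : Type u) : Type u :=
  Antisymmetrization (LatticeTerm α) (· ≤ ·)

namespace FreeLattice

/-- The element of the free lattice represented by a term. -/
def mk {α : Type u} (t : LatticeTerm α) : FreeLattice α :=
  toAntisymmetrization (· ≤ ·) t

instance {α : Type u} : PartialOrder (FreeLattice α) :=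
  inferInstanceAs (PartialOrder (Antisymmetrization (LatticeTerm α) (· ≤ ·)))

theorem mk_le_mk {α : Type u} {s t : LatticeTerm α} : mk s ≤ mk t ↔ LatticeTerm.Le s t :=
  Iff.rfl

theorem ind {α : Type u} {p : FreeLattice α → Prop} (h : ∀ t, p (mk t)) (x : FreeLattice α) :
    p x :=
  Quotient.inductionOn' x h

instance {α : Type u} : Lattice (FreeLattice α) where
  sup := Quotient.map₂ LatticeTerm.sup (by
    rintro a b ⟨h₁, h₂⟩ c d ⟨h₃, h₄⟩
    exact ⟨.sup_le (.trans h₁ (.le_sup_left _ _)) (.trans h₃ (.le_sup_right _ _)),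
      .sup_le (.trans h₂ (.le_sup_left _ _)) (.trans h₄ (.le_sup_right _ _))⟩)
  inf := Quotient.map₂ LatticeTerm.inf (by
    rintro a b ⟨h₁, h₂⟩ c d ⟨h₃, h₄⟩
    exact ⟨.le_inf (.trans (.inf_le_left _ _) h₁) (.trans (.inf_le_right _ _) h₃),
      .le_inf (.trans (.inf_le_left _ _) h₂) (.trans (.inf_le_right _ _) h₄)⟩)
  le_sup_left := ind fun s => ind fun t => LatticeTerm.Le.le_sup_left s t
  le_sup_right := ind fun s => ind fun t => LatticeTerm.Le.le_sup_right s t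
  sup_le := ind fun _ => ind fun _ => ind fun _ => LatticeTerm.Le.sup_le
  inf_le_left := ind fun s => ind fun t => LatticeTerm.Le.inf_le_left s t
  inf_le_right := ind fun s => ind fun t => LatticeTerm.Le.inf_le_right s t
  le_inf := ind fun _ => ind fun _ => ind fun _ => LatticeTerm.Le.le_inf

/-- The universal property of the free lattice: every map from `α` to a lattice extends
uniquely to a lattice homomorphism. -/
theorem existsUnique_lift {α : Type u} {L : Type v} [Lattice L] (f : α → L) :
    ∃! φ : LatticeHom (FreeLattice α) L, ∀ x, φ (mk (.var x)) = f x := by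
  let φ : LatticeHom (FreeLattice α) L :=
    { toFun := fun x => Quotient.liftOn' x (LatticeTerm.eval f) fun _ _ h =>
        le_antisymm (LatticeTerm.eval_mono f h.1) (LatticeTerm.eval_mono f h.2)
      map_sup' := ind fun _ => ind fun _ => rfl
      map_inf' := ind fun _ => ind fun _ => rfl }
  refine ⟨φ, fun _ => rfl, fun ψ hψ => DFunLike.ext _ _ (ind fun t => ?_)⟩
  change ψ (mk t) = LatticeTerm.eval f t
  induction t with
  | var x => exact hψ x
  | sup s t hs ht => exact (map_sup ψ (mk s) (mk t)).trans (congrArg₂ (· ⊔ ·) hs ht)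
  | inf s t hs ht => exact (map_inf ψ (mk s) (mk t)).trans (congrArg₂ (· ⊓ ·) hs ht)

end FreeLattice

/-- The underlying set of the pentagon: a least element `zero`, a greatest element `one`, a
chain `p < q` strictly between them, and an element `r` incomparable to `p` and to `q`. -/
inductive N5 : Type
  | zero | p | q | r | one
  deriving DecidableEq

namespace N5

/-- The join operation of the pentagon. -/
def join : N5 → N5 → N5
  | zero, x => x
  | x, zero => x
  | p, p => p
  | p, q => q
  | q, p => q
  | q, q => q
  | r, r => r
  | _, _ => one

/-- The meet operation of the pentagon. -/
def meet : N5 → N5 → N5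
  | one, x => x
  | x, one => x
  | p, p => p
  | p, q => p
  | q, p => p
  | q, q => q
  | r, r => r
  | _, _ => zero

/-- The pentagon as a lattice; its order is `x ≤ y ↔ x ⊔ y = y`. -/
instance : Lattice N5 where
  le x y := join x y = y
  sup := join
  inf := meet
  le_refl := by rintro ⟨⟩ <;> rfl
  le_trans := by rintro ⟨⟩ ⟨⟩ ⟨⟩ <;> simp [join]
  le_antisymm := by rintro ⟨⟩ ⟨⟩ <;> simp [join]
  le_sup_left := by rintro ⟨⟩ ⟨⟩ <;> rfl
  le_sup_right := by rintro ⟨⟩ ⟨⟩ <;> rfl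
  sup_le := by rintro ⟨⟩ ⟨⟩ ⟨⟩ <;> simp [join]
  inf_le_left := by rintro ⟨⟩ ⟨⟩ <;> rfl
  inf_le_right := by rintro ⟨⟩ ⟨⟩ <;> rfl
  le_inf := by rintro ⟨⟩ ⟨⟩ ⟨⟩ <;> simp [join, meet]

end N5

/-- The identity `s = t` holds in the lattice `L`. -/
def SatisfiesIdentity (L : Type u) [Lattice L] (s t : LatticeTerm ℕ) : Prop :=
  ∀ f : ℕ → L, s.eval f = t.eval f

/-- `L` belongs to the variety of lattices generated by `K`, the smallest class of lattices
that contains `K` and is defined by identities: every identity of `K` holds in `L`. -/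
def InVarietyGeneratedBy (K : Type v) [Lattice K] (L : Type u) [Lattice L] : Prop :=
  ∀ s t : LatticeTerm ℕ, SatisfiesIdentity K s t → SatisfiesIdentity L s t

/-! ### Whitman's condition -/

/-- Whitman's condition: a meet lies below a join only for one of the four evident reasons. -/
def WhitmanCondition (L : Type u) [Lattice L] : Prop :=
  ∀ a b c d : L, a ⊓ b ≤ c ⊔ d → a ≤ c ⊔ d ∨ b ≤ c ⊔ d ∨ a ⊓ b ≤ c ∨ a ⊓ b ≤ d

/-- Day's doubling of the interval `[u, v]` of a lattice: each point of the interval is split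
into a lower and an upper copy. Points outside the interval carry the flag `upper` exactly when
they are not below `v`. -/
@[ext]
structure IntervalDoubling {L : Type u} [Lattice L] (u v : L) : Type u where
  point : L
  upper : Prop
  not_upper : point ≤ v → ¬ u ≤ point → ¬ upper
  upper_of_not_le : ¬ point ≤ v → upper

namespace IntervalDoubling

variable {L : Type u} [Lattice L] {u v : L}

instance : PartialOrder (IntervalDoubling u v) where
  le x y := x.point ≤ y.point ∧ (x.upper → y.upper)
  le_refl _ := ⟨le_rfl, id⟩
  le_trans _ _ _ h k := ⟨h.1.trans k.1, k.2 ∘ h.2⟩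
  le_antisymm _ _ h k :=
    IntervalDoubling.ext (le_antisymm h.1 k.1) (propext ⟨h.2, k.2⟩)

instance : Lattice (IntervalDoubling u v) where
  sup x y :=
    { point := x.point ⊔ y.point
      upper := x.upper ∨ y.upper ∨ ¬ x.point ⊔ y.point ≤ v
      not_upper := by
        rintro h hu (hx | hy | hn)
        · exact x.not_upper (le_sup_left.trans h) (fun k => hu (k.trans le_sup_left)) hx
        · exact y.not_upper (le_sup_right.trans h) (fun k => hu (k.trans le_sup_right)) hy
        · exact hn h
      upper_of_not_le := fun h => .inr (.inr h) }
  inf x y :=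
    { point := x.point ⊓ y.point
      upper := x.upper ∧ y.upper ∧ (x.point ⊓ y.point ≤ v → u ≤ x.point ⊓ y.point)
      not_upper := fun h hu k => hu (k.2.2 h)
      upper_of_not_le := fun h =>
        ⟨x.upper_of_not_le fun k => h (inf_le_left.trans k),
          y.upper_of_not_le fun k => h (inf_le_right.trans k), fun k => (h k).elim⟩ }
  le_sup_left _ _ := ⟨le_sup_left, .inl⟩
  le_sup_right _ _ := ⟨le_sup_right, fun h => .inr (.inl h)⟩
  sup_le x y z h k := by
    refine ⟨sup_le h.1 k.1, ?_⟩
    rintro (hx | hy | hn)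
    · exact h.2 hx
    · exact k.2 hy
    · exact z.upper_of_not_le fun hz => hn ((sup_le h.1 k.1).trans hz)
  inf_le_left _ _ := ⟨inf_le_left, fun h => h.1⟩
  inf_le_right _ _ := ⟨inf_le_right, fun h => h.2.1⟩
  le_inf x y z h k := by
    refine ⟨le_inf h.1 k.1, fun hx => ⟨h.2 hx, k.2 hx, fun hv => ?_⟩⟩
    by_contra hu
    exact x.not_upper ((le_inf h.1 k.1).trans hv) (fun hux => hu (hux.trans (le_inf h.1 k.1))) hx

/-- The projection of the doubling onto the original lattice. -/
def proj (u v : L) : LatticeHom (IntervalDoubling u v) L where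
  toFun := point
  map_sup' _ _ := rfl
  map_inf' _ _ := rfl

/-- The lower copy of a point. -/
def lower (u v x : L) : IntervalDoubling u v where
  point := x
  upper := ¬ x ≤ v
  not_upper h _ k := k h
  upper_of_not_le := id

end IntervalDoubling

/-- Free lattices satisfy Whitman's condition. -/
theorem FreeLattice.whitmanCondition (X : Type u) : WhitmanCondition (FreeLattice X) := by
  intro a b c d h
  by_contra! hn
  obtain ⟨ha, hb, hc, hd⟩ := hn
  obtain ⟨φ, hφ, -⟩ := existsUnique_lift
    fun x : X => IntervalDoubling.lower (a ⊓ b) (c ⊔ d) (mk (.var x))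
  have hsection : (IntervalDoubling.proj (a ⊓ b) (c ⊔ d)).comp φ = LatticeHom.id _ := by
    refine (existsUnique_lift fun x : X => (mk (.var x) : FreeLattice X)).unique (fun x => ?_)
      fun _ => rfl
    exact congrArg IntervalDoubling.point (hφ x)
  have hpoint (x : FreeLattice X) : (φ x).point = x := DFunLike.congr_fun hsection x
  have hle : φ a ⊓ φ b ≤ φ c ⊔ φ d := by
    rw [← map_inf, ← map_sup]
    exact OrderHomClass.mono φ h
  have hupper : (φ a ⊓ φ b).upper := by
    refine ⟨(φ a).upper_of_not_le ?_, (φ b).upper_of_not_le ?_, fun _ => ?_⟩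
    · rwa [hpoint]
    · rwa [hpoint]
    · rw [hpoint, hpoint]
  rcases hle.2 hupper with hcu | hdu | hv
  · refine (φ c).not_upper ?_ ?_ hcu
    · rw [hpoint]
      exact le_sup_left
    · rwa [hpoint]
  · refine (φ d).not_upper ?_ ?_ hdu
    · rw [hpoint]
      exact le_sup_right
    · rwa [hpoint]
  · rw [hpoint, hpoint] at hv
    exact hv le_rfl

namespace WhitmanCondition

variable {L : Type u} {M : Type v} [Lattice L] [Lattice M]

/-- Whitman's condition passes to sublattices. -/
theorem sublattice (h : WhitmanCondition L) (S : Sublattice L) : WhitmanCondition S :=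
  fun a b c d => h a b c d

theorem of_orderIso (h : WhitmanCondition M) (e : L ≃o M) : WhitmanCondition L := by
  intro a b c d habcd
  have := h (e a) (e b) (e c) (e d)
  simp only [← map_inf, ← map_sup, e.le_iff_le] at this
  exact this habcd

theorem dual (h : WhitmanCondition L) : WhitmanCondition Lᵒᵈ := by
  intro a b c d habcd
  rcases h c.ofDual d.ofDual a.ofDual b.ofDual habcd with h | h | h | h
  · exact .inr (.inr (.inl h))
  · exact .inr (.inr (.inr h))
  · exact .inl h
  · exact .inr (.inl h)

end WhitmanCondition

/-! ### Duality for the variety generated by the pentagon -/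

namespace LatticeTerm

/-- The dual term, with joins and meets exchanged. -/
def dual {α : Type u} : LatticeTerm α → LatticeTerm α
  | var x => var x
  | sup s t => inf (dual s) (dual t)
  | inf s t => sup (dual s) (dual t)

theorem ofDual_eval {α : Type u} {L : Type v} [Lattice L] (f : α → Lᵒᵈ) (t : LatticeTerm α) :
    (t.eval f).ofDual = t.dual.eval fun x => (f x).ofDual := by
  induction t with
  | var x => rfl
  | sup s t hs ht => exact congrArg₂ (· ⊓ ·) hs ht
  | inf s t hs ht => exact congrArg₂ (· ⊔ ·) hs ht

end LatticeTerm

namespace N5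

/-- The order-reversing involution of the pentagon. -/
def compl : N5 → N5
  | zero => one
  | p => q
  | q => p
  | r => r
  | one => zero

theorem compl_compl (x : N5) : x.compl.compl = x := by
  cases x <;> rfl

theorem compl_sup (x y : N5) : (x ⊔ y).compl = x.compl ⊓ y.compl := by
  cases x <;> cases y <;> rfl

theorem compl_inf (x y : N5) : (x ⊓ y).compl = x.compl ⊔ y.compl := by
  cases x <;> cases y <;> rfl

theorem compl_eval {α : Type u} (f : α → N5) (t : LatticeTerm α) :
    (t.eval f).compl = t.dual.eval fun x => (f x).compl := by
  induction t with
  | var x => rfl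
  | sup s t hs ht => exact (compl_sup _ _).trans (congrArg₂ (· ⊓ ·) hs ht)
  | inf s t hs ht => exact (compl_inf _ _).trans (congrArg₂ (· ⊔ ·) hs ht)

instance : Fintype N5 where
  elems := {zero, p, q, r, one}
  complete x := by cases x <;> decide

instance : DecidableLE N5 := fun x y => inferInstanceAs (Decidable (join x y = y))

end N5

namespace InVarietyGeneratedBy

theorem dual {L : Type u} [Lattice L] (hL : InVarietyGeneratedBy N5 L) :
    InVarietyGeneratedBy N5 Lᵒᵈ := by
  intro s t hst f
  apply OrderDual.ofDual.injective
  rw [LatticeTerm.ofDual_eval, LatticeTerm.ofDual_eval]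
  refine hL _ _ (fun g => ?_) _
  have := congrArg N5.compl (hst fun x => (g x).compl)
  simpa only [N5.compl_eval, N5.compl_compl] using this

/-- Inequalities between terms transfer from the generating lattice. -/
theorem eval_le {K : Type v} {L : Type u} [Lattice K] [Lattice L]
    (hL : InVarietyGeneratedBy K L) {s t : LatticeTerm ℕ}
    (h : ∀ f : ℕ → K, s.eval f ≤ t.eval f) (f : ℕ → L) : s.eval f ≤ t.eval f :=
  inf_eq_left.mp (hL (.inf s t) s (fun g => inf_eq_left.mpr (h g)) f)

end InVarietyGeneratedBy

/-! ### Inequalities of the pentagon -/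

namespace N5

theorem sup_inf_sup_le : ∀ b c : N5, b ≤ c → ∀ e, c ≤ e → ∀ a x, x ≤ a ⊔ b →
    (x ⊔ e) ⊓ (a ⊔ c) ≤ ((x ⊔ e) ⊓ (a ⊔ b)) ⊔ ((a ⊔ c) ⊓ e) := by
  decide +kernel

theorem sup_inf_inf_sup_le : ∀ b c : N5, b ≤ c → ∀ x, c ≤ x → ∀ a,
    (a ⊔ b) ⊓ ((a ⊓ x) ⊔ c) ≤ ((a ⊔ b) ⊓ c) ⊔ (a ⊓ x) := by
  decide +kernel

theorem inf_sup_le : ∀ b e : N5, b ≤ e → ∀ x, b ≤ x → ∀ a,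
    x ⊓ ((a ⊓ (x ⊔ e)) ⊔ b) ≤ e ⊔ (a ⊓ x) := by
  decide +kernel

end N5

section

variable {L : Type u} [Lattice L]

open LatticeTerm

theorem InVarietyGeneratedBy.sup_inf_sup_le (hL : InVarietyGeneratedBy N5 L) {a b c e x : L}
    (hbc : b ≤ c) (hce : c ≤ e) (hx : x ≤ a ⊔ b) :
    (x ⊔ e) ⊓ (a ⊔ c) ≤ ((x ⊔ e) ⊓ (a ⊔ b)) ⊔ ((a ⊔ c) ⊓ e) := by
  let A := var 0
  let B := var 1
  let C := sup B (var 2)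
  let E := sup C (var 3)
  let Y := inf (var 4) (sup A B)
  have := hL.eval_le (s := inf (sup Y E) (sup A C))
    (t := sup (inf (sup Y E) (sup A B)) (inf (sup A C) E))
    (fun f => N5.sup_inf_sup_le _ _ le_sup_left _ le_sup_left _ _ inf_le_right)
    fun n => [a, b, c, e, x].getD n a
  simpa [A, B, C, E, Y, eval, sup_eq_right.mpr hbc, sup_eq_right.mpr hce,
    inf_eq_left.mpr hx] using this

theorem InVarietyGeneratedBy.sup_inf_inf_sup_le (hL : InVarietyGeneratedBy N5 L) {a b c x : L}
    (hbc : b ≤ c) (hcx : c ≤ x) :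
    (a ⊔ b) ⊓ ((a ⊓ x) ⊔ c) ≤ ((a ⊔ b) ⊓ c) ⊔ (a ⊓ x) := by
  let A := var 0
  let B := var 1
  let C := sup B (var 2)
  let Y := sup C (var 3)
  have := hL.eval_le (s := inf (sup A B) (sup (inf A Y) C))
    (t := sup (inf (sup A B) C) (inf A Y))
    (fun f => N5.sup_inf_inf_sup_le _ _ le_sup_left _ le_sup_left _)
    fun n => [a, b, c, x].getD n a
  simpa [A, B, C, Y, eval, sup_eq_right.mpr hbc, sup_eq_right.mpr hcx] using this

theorem InVarietyGeneratedBy.inf_sup_le (hL : InVarietyGeneratedBy N5 L) {a b e x : L}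
    (hbe : b ≤ e) (hbx : b ≤ x) :
    x ⊓ ((a ⊓ (x ⊔ e)) ⊔ b) ≤ e ⊔ (a ⊓ x) := by
  let A := var 0
  let B := var 1
  let E := sup B (var 2)
  let Y := sup B (var 3)
  have := hL.eval_le (s := inf Y (sup (inf A (sup Y E)) B)) (t := sup E (inf A Y))
    (fun f => N5.inf_sup_le _ _ le_sup_left _ le_sup_left _)
    fun n => [a, b, e, x].getD n a
  simpa [A, B, E, Y, eval, sup_eq_right.mpr hbe, sup_eq_right.mpr hbx] using this

theorem WhitmanCondition.inf_le_of_not_le_sup (hW : WhitmanCondition L)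
    (hL : InVarietyGeneratedBy N5 L) {a b c x : L} (hbc : b ≤ c) (hcx : c ≤ x)
    (hba : ¬ b ≤ a) (hca : ¬ c ≤ a ⊔ b) (hax : ¬ a ≤ x) : a ⊓ x ≤ c := by
  rcases hW _ _ _ _ (hL.sup_inf_inf_sup_le (a := a) hbc hcx) with h | h | h | h
  · exact absurd (le_sup_left.trans (h.trans (sup_le (inf_le_right.trans hcx) inf_le_right))) hax
  · exact absurd (le_sup_right.trans
      (h.trans (sup_le inf_le_left (inf_le_left.trans le_sup_left)))) hca
  · exact (le_inf (inf_le_left.trans le_sup_left) le_sup_left).trans (h.trans inf_le_right)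
  · exact absurd ((le_inf le_sup_right (hbc.trans le_sup_right)).trans
      (h.trans inf_le_left)) hba

theorem WhitmanCondition.le_sup_of_not_le_sup (hW : WhitmanCondition L)
    (hL : InVarietyGeneratedBy N5 L) {a b c e x : L} (hbc : b ≤ c) (hce : c ≤ e)
    (hx : x ≤ a ⊔ b) (hxe : ¬ x ≤ e) (hca : ¬ c ≤ a ⊔ b) (hea : ¬ e ≤ a ⊔ c) :
    a ≤ x ⊔ e := by
  rcases hW _ _ _ _ (hL.sup_inf_sup_le hbc hce hx) with h | h | h | h
  · exact absurd (le_sup_right.trans (h.trans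
      (sup_le (inf_le_right.trans (sup_le_sup_left hbc a)) inf_le_left))) hea
  · exact le_sup_left.trans (h.trans (sup_le inf_le_left (inf_le_right.trans le_sup_right)))
  · exact absurd ((le_inf (hce.trans le_sup_right) le_sup_right).trans (h.trans inf_le_right)) hca
  · exact absurd ((le_inf le_sup_left (hx.trans (sup_le_sup_left hbc a))).trans
      (h.trans inf_le_right)) hxe

theorem not_le_sup_of_sup_lt_sup {a b c : L} (h : a ⊔ b < a ⊔ c) : ¬ c ≤ a ⊔ b :=
  fun hc => h.not_ge (sup_le le_sup_left hc)

/-- The covering relation holds in every lattice of the variety of the pentagon that satisfies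
Whitman's condition. -/
theorem WhitmanCondition.sup_inf_covBy_sup (hW : WhitmanCondition L)
    (hL : InVarietyGeneratedBy N5 L) {a b₁ b₂ b₃ b₄ b₅ : L} (hb₁ : ¬ b₁ ≤ a) (hb₅ : ¬ a ≤ b₅)
    (h₁₂ : b₁ ≤ b₂) (h₂₃ : b₂ ≤ b₃) (h₃₄ : b₃ ≤ b₄) (h₄₅ : b₄ ≤ b₅)
    (k₁₂ : a ⊔ b₁ < a ⊔ b₂) (k₃₄ : a ⊔ b₃ < a ⊔ b₄) (k₄₅ : a ⊔ b₄ < a ⊔ b₅) :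
    (a ⊔ b₃) ⊓ b₅ ⋖ a ⊔ b₃ := by
  refine ⟨inf_lt_left.mpr fun h => hb₅ (le_sup_left.trans h), fun x hdx hxc => ?_⟩
  have h₃₅ : b₃ ≤ b₅ := h₃₄.trans h₄₅
  have h₃x : b₃ ≤ x := (le_inf le_sup_right h₃₅).trans hdx.le
  have hxe : ¬ x ≤ b₅ := fun h => hdx.not_ge (le_inf hxc.le h)
  have hax : ¬ a ≤ x := fun h => hxc.not_ge (sup_le h h₃x)
  have hmeet : a ⊓ x ≤ b₂ := hW.inf_le_of_not_le_sup hL h₁₂ (h₂₃.trans h₃x) hb₁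
    (not_le_sup_of_sup_lt_sup k₁₂) hax
  have hjoin : a ≤ x ⊔ b₅ := hW.le_sup_of_not_le_sup hL h₃₄ h₄₅ hxc.le hxe
    (not_le_sup_of_sup_lt_sup k₃₄) (not_le_sup_of_sup_lt_sup k₄₅)
  have hle := hL.inf_sup_le (a := a) h₃₅ h₃x
  rw [inf_eq_left.mpr hjoin, inf_eq_left.mpr hxc.le] at hle
  exact hxe (hle.trans (sup_le le_rfl (hmeet.trans (h₂₃.trans h₃₅))))

end

theorem theorem5 {L : Type*} [Lattice L] (hN : InVarietyGeneratedBy N5 L)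
    {X : Type*} (hfree : ∃ S : Sublattice (FreeLattice X), Nonempty (L ≃o S)) :
    (∀ a b₁ b₂ b₃ b₄ b₅ : L,
      (∀ b ∈ [b₁, b₂, b₃, b₄, b₅], ¬ a ≤ b ∧ ¬ b ≤ a) →
      b₁ < b₂ → b₂ < b₃ → b₃ < b₄ → b₄ < b₅ →
      a ⊔ b₁ < a ⊔ b₂ → a ⊔ b₂ < a ⊔ b₃ → a ⊔ b₃ < a ⊔ b₄ → a ⊔ b₄ < a ⊔ b₅ →
      (a ⊔ b₄) ⊓ b₅ ≠ b₄ →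
      (a ⊔ b₃) ⊓ b₅ ⋖ a ⊔ b₃) ∧
    (∀ a b₁ b₂ b₃ b₄ b₅ : L,
      (∀ b ∈ [b₁, b₂, b₃, b₄, b₅], ¬ a ≤ b ∧ ¬ b ≤ a) →
      b₂ < b₁ → b₃ < b₂ → b₄ < b₃ → b₅ < b₄ →
      a ⊓ b₂ < a ⊓ b₁ → a ⊓ b₃ < a ⊓ b₂ → a ⊓ b₄ < a ⊓ b₃ → a ⊓ b₅ < a ⊓ b₄ →
      (a ⊓ b₄) ⊔ b₅ ≠ b₄ →
      a ⊓ b₃ ⋖ (a ⊓ b₃) ⊔ b₅) := by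
  obtain ⟨S, ⟨e⟩⟩ := hfree
  have hW : WhitmanCondition L :=
    ((FreeLattice.whitmanCondition X).sublattice S).of_orderIso e
  constructor
  · intro a b₁ b₂ b₃ b₄ b₅ hb h₁₂ h₂₃ h₃₄ h₄₅ k₁₂ _ k₃₄ k₄₅ _
    exact hW.sup_inf_covBy_sup hN (hb b₁ (by simp)).2 (hb b₅ (by simp)).1
      h₁₂.le h₂₃.le h₃₄.le h₄₅.le k₁₂ k₃₄ k₄₅
  · intro a b₁ b₂ b₃ b₄ b₅ hb h₁₂ h₂₃ h₃₄ h₄₅ k₁₂ _ k₃₄ k₄₅ _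
    exact toDual_covBy_toDual_iff.mp <| hW.dual.sup_inf_covBy_sup hN.dual
      (a := .toDual a) (b₁ := .toDual b₁) (b₂ := .toDual b₂) (b₃ := .toDual b₃)
      (b₄ := .toDual b₄) (b₅ := .toDual b₅) (hb b₁ (by simp)).1 (hb b₅ (by simp)).2
      h₁₂.le h₂₃.le h₃₄.le h₄₅.le k₁₂ k₃₄ k₄₅
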